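/- Let $J=\mathrm{diag}(1,-1,1,-1,1)$, let $a\in\mathbb R$, $b_1,b_2,b_3,b_4\in\mathbb C$, and let $A$ be the centrosymmetric tridiagonal matrix of order $5$ with main diagonal $(a,-a,a,-a,a)$, upper subdiagonal $(b_1,b_2,b_3,b_4)$ and lower subdiagonal $(b_4,b_3,b_2,b_1)$. Put $$\Delta_1=a^2+b_1b_4,\quad M_1=2a^2-|b_1|^2-|b_4|^2,\quad \Delta_2=\Delta_1+2b_2b_3,\quad M_2=M_1-2|b_2|^2-2|b_3|^2 .$$ Write $[x,y]_J=y^*Jx$ and let $W^J(A)=-W^J_-(A)\cup W^J_+(A)$, where $W^J_\pm(A)=\{[Ax,x]_J: x\in\mathbb C^5,\ [x,x]_J=\pm1\}$, be the Krein space numerical range of $A$. With $A^\#=JA^*J$, $\Re^J(A)=\frac{A+A^\#}{2}$ and $\Im^J(A)=\frac{A-A^\#}{2i}$, let $C^J(A)$ be the set of real affine points (identified with points of $\mathbb C$) of the algebraic curve with equation $\det(u\,\Re^J(A)+v\,\Im^J(A)+w\,I_5)=0$ in homogeneous line coordinates $(u,v,w)$, that is, of the union of the dual curves of the irreducible components of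 this equation, a linear component giving a point. For $k=1,2$ let $\mathcal H_k$ be the hyperbola (both branches) with foci $\pm\sqrt{\Delta_k}$ and non-transverse axis of length $(2|\Delta_k|-M_k)^{1/2}$; it is nondegenerate if $2|\Delta_k|-M_k>0$ and $(2|\Delta_k|-M_k)^{1/2}<2|\Delta_k|^{1/2}$, so that both axes have positive length. Then $\mathcal H_2$ is nondegenerate and $W^J(A)$ is bounded by $\mathcal H_2$, i.e. $\partial W^J(A)=\mathcal H_2$, if and only if $|M_2|<2|\Delta_2|$. In this case, $W^J(A)$ is the closed hyperbolic disc bounded by $\mathcal H_2$ (the union of the two closed convex regions bounded by its branches), and either $\mathcal H_1$ is nondegenerate and $C^J(A)=\{a\}\cup\mathcal H_1\cup\mathcal H_2$, or $2|\Delta_1|-M_1=0$, $\mathcal H_1$ degenerates into the points $\pm\sqrt{\Delta_1}$, and $C^J(A)=\{a\}\cup\{\sqrt{\Delta_1},-\sqrt{\Delta_1}\}\cup\mathcal H_2$. -/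

import Mathlib

open Matrix

namespace KreinRange

variable {n : Type} [Fintype n] [DecidableEq n]

/-- The indefinite inner product `[x, y]_J = y* J x` on `ℂⁿ`. -/
def indefInner (J : Matrix n n ℂ) (x y : n → ℂ) : ℂ :=
  star y ⬝ᵥ (J *ᵥ x)

/-- `W^J_+(A) = {[Ax, x]_J : [x, x]_J = 1}`. -/
def knrPos (J A : Matrix n n ℂ) : Set ℂ :=
  {z | ∃ x : n → ℂ, indefInner J x x = 1 ∧ indefInner J (A *ᵥ x) x = z}

/-- `W^J_-(A) = {[Ax, x]_J : [x, x]_J = -1}`. -/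
def knrNeg (J A : Matrix n n ℂ) : Set ℂ :=
  {z | ∃ x : n → ℂ, indefInner J x x = -1 ∧ indefInner J (A *ᵥ x) x = z}

/-- The Krein space numerical range `W^J(A) = -W^J_-(A) ∪ W^J_+(A)`. -/
def knr (J A : Matrix n n ℂ) : Set ℂ :=
  {z | -z ∈ knrNeg J A} ∪ knrPos J A

/-- The `J`-adjoint `A^# = J A* J`. -/
def jAdjoint (J A : Matrix n n ℂ) : Matrix n n ℂ :=
  J * Aᴴ * J

/-- `Re^J(A) = (A + A^#) / 2`. -/
noncomputable def reJ (J A : Matrix n n ℂ) : Matrix n n ℂ :=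
  (1 / 2 : ℂ) • (A + jAdjoint J A)

/-- `Im^J(A) = (A - A^#) / (2i)`. -/
noncomputable def imJ (J A : Matrix n n ℂ) : Matrix n n ℂ :=
  (1 / (2 * Complex.I)) • (A - jAdjoint J A)

/-- The form `det (u Re^J(A) + v Im^J(A) + w I)` in the homogeneous line coordinates
`(u, v, w) = (X 0, X 1, X 2)`. -/
noncomputable def lineForm (J A : Matrix n n ℂ) : MvPolynomial (Fin 3) ℂ :=
  ((MvPolynomial.X 0 : MvPolynomial (Fin 3) ℂ) • (reJ J A).map MvPolynomial.C
    + (MvPolynomial.X 1 : MvPolynomial (Fin 3) ℂ) • (imJ J A).map MvPolynomial.C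
    + (MvPolynomial.X 2 : MvPolynomial (Fin 3) ℂ) • (1 : Matrix n n (MvPolynomial (Fin 3) ℂ))).det

/-- The gradient of a ternary polynomial at a point. -/
noncomputable def grad (G : MvPolynomial (Fin 3) ℂ) (p : Fin 3 → ℂ) : Fin 3 → ℂ :=
  fun i => MvPolynomial.eval p (MvPolynomial.pderiv i G)

/-- The cone over the dual curve of the plane projective curve `G = 0`, for `G` an irreducible
form: the Zariski closure of the cone spanned by the tangents `grad G p` at the points `p` of the
curve. (Singular points contribute only the origin; for a linear form, the dual is the single point
of the projective plane given by the coefficients of the form.) -/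
def dualCone (G : MvPolynomial (Fin 3) ℂ) : Set (Fin 3 → ℂ) :=
  {q | ∀ P : MvPolynomial (Fin 3) ℂ,
    (∀ (p : Fin 3 → ℂ) (t : ℂ), MvPolynomial.eval p G = 0 →
      MvPolynomial.eval (t • grad G p) P = 0) →
    MvPolynomial.eval q P = 0}

/-- `C^J(A)`, the real part of the boundary generating curve of `W^J(A)`: the real affine points
`x + iy`, that is `[x : y : 1]`, of the curve whose equation in line coordinates is
`det (u Re^J(A) + v Im^J(A) + w I) = 0`, which is the union of the dual curves of the irreducible
components of that equation. -/
def boundaryCurve (J A : Matrix n n ℂ) : Set ℂ :=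
  {z | ∃ G : MvPolynomial (Fin 3) ℂ, Irreducible G ∧ G ∣ lineForm J A ∧
    ![(z.re : ℂ), (z.im : ℂ), 1] ∈ dualCone G}

/-- The tridiagonal matrix `T₅(c, a, b)` with lower subdiagonal `c`, main diagonal `a` and upper
subdiagonal `b`. -/
def tridiag5 (c : Fin 4 → ℂ) (a : Fin 5 → ℂ) (b : Fin 4 → ℂ) : Matrix (Fin 5) (Fin 5) ℂ :=
  !![a 0, b 0, 0, 0, 0;
     c 0, a 1, b 1, 0, 0;
     0, c 1, a 2, b 2, 0;
     0, 0, c 2, a 3, b 3;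
     0, 0, 0, c 3, a 4]

/-- The length of the transverse axis of a hyperbola with foci `f`, `g` and non-transverse axis of
length `l`. -/
noncomputable def transverseLength (f g : ℂ) (l : ℝ) : ℝ :=
  Real.sqrt (dist f g ^ 2 - l ^ 2)

/-- The foci `f`, `g` and the length `l` of the non-transverse axis are those of a nondegenerate
hyperbola: `l`, and with it the length of the transverse axis, is positive. -/
def IsNondegenerateHyperbola (f g : ℂ) (l : ℝ) : Prop :=
  0 < l ∧ l < dist f g

/-- The hyperbola (both branches) with foci `f`, `g` and non-transverse axis of length `l`. -/
noncomputable def hyperbola (f g : ℂ) (l : ℝ) : Set ℂ :=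
  {z | |dist z f - dist z g| = transverseLength f g l}

/-- The closed hyperbolic disc: the two closed convex regions cut out by the branches of the
hyperbola. -/
noncomputable def hyperbolicDisc (f g : ℂ) (l : ℝ) : Set ℂ :=
  {z | transverseLength f g l ≤ |dist z f - dist z g|}

end KreinRange

/-! Up to normalization, W^J(A) is the set of quotients z = [Ax, x]/[x, x] with [x, x] ≠ 0
(`mem_knr_iff`). Everything is governed by the real quadratic form q(ζ) = (Re(ζ²Δ₂) + |ζ|²M₂/2)/2,
which equals c² - S, where c = a Re ζ and √S is the norm of the 3×2 block of Re^J(ζA) joining the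
positive coordinates to the negative ones.

Upper bound: a reverse Cauchy-Schwarz inequality gives q(ζ) ≤ Re(ζz)² for every ζ, and letting ζ
vary gives 2|z² - Δ₂| ≤ 2|z|² - M₂ (`knr_centro5_subset`). This is the focal inequality of the
hyperbolic disc; squared, it becomes the polynomial inequality `conicValue` ≥ 0.

Attainment: if |M₂| < 2|Δ₂|, then q is nonsingular and z is half the gradient of q at some k with
q(k) = Re(kz). `conicValue` ≥ 0 says exactly that q(k) ≥ 1, which is what is needed to build a
vector (p, r, s, r, p) with value z (`mem_knr_centro5_of_dual`). The norm bound defining S is tight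
on such symmetric vectors, so the outer hyperbola is the one that appears.

Curve: the splitting into symmetric and antisymmetric vectors factors the determinant into a linear
form and two conics w² - q (`lineForm_centro5`). A nonsingular conic dualizes to its hyperbola, by
the adjugate; when M₁ = 2|Δ₁| the first conic splits into two lines, dual to the foci. -/

namespace KreinRange

/-! ### Focal and polynomial equations of the hyperbola -/

open ComplexConjugate in
/-- `8 Re(conj Δ z²) - 4 M |z|² - (4|Δ|² - M²)`, an equation of the hyperbola with foci `±√Δ` and
non-transverse axis `√(2|Δ| - M)`. -/
noncomputable def conicValue (Δ : ℂ) (M : ℝ) (z : ℂ) : ℝ :=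
  8 * (conj Δ * z ^ 2).re - 4 * M * ‖z‖ ^ 2 - (4 * ‖Δ‖ ^ 2 - M ^ 2)

lemma transverseLength_nonneg (f g : ℂ) (l : ℝ) : 0 ≤ transverseLength f g l :=
  Real.sqrt_nonneg _

section Hyperbola

variable {Δ δ z : ℂ} {M l : ℝ}

lemma continuous_conicValue (Δ : ℂ) (M : ℝ) : Continuous (conicValue Δ M) := by
  unfold conicValue; fun_prop

lemma norm_eq_sq (hδ : δ ^ 2 = Δ) : ‖Δ‖ = ‖δ‖ ^ 2 := by rw [← hδ, norm_pow]

lemma dist_focus_neg : dist δ (-δ) = 2 * ‖δ‖ := by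
  rw [dist_eq_norm, sub_neg_eq_add, ← two_mul]; simp

lemma sq_transverseLength (hδ : δ ^ 2 = Δ) (hl : l = Real.sqrt (2 * ‖Δ‖ - M))
    (h₁ : M ≤ 2 * ‖Δ‖) (h₂ : -M ≤ 2 * ‖Δ‖) :
    transverseLength δ (-δ) l ^ 2 = 2 * ‖Δ‖ + M := by
  have : dist δ (-δ) ^ 2 - l ^ 2 = 2 * ‖Δ‖ + M := by
    rw [hl, Real.sq_sqrt (by linarith), dist_focus_neg, norm_eq_sq hδ]; ring
  rw [transverseLength, this, Real.sq_sqrt (by linarith)]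

/-- The cross term is |z - δ||z + δ| = |z² - Δ|; the squares are summed by the parallelogram law. -/
lemma sq_dist_sub_dist (hδ : δ ^ 2 = Δ) :
    (dist z δ - dist z (-δ)) ^ 2 = 2 * ‖z‖ ^ 2 + 2 * ‖Δ‖ - 2 * ‖z ^ 2 - Δ‖ := by
  have h1 : ‖z ^ 2 - Δ‖ = ‖z - δ‖ * ‖z + δ‖ := by
    rw [← norm_mul, ← hδ]; ring_nf
  have h2 := parallelogram_law_with_norm ℝ z δ
  rw [dist_eq_norm, dist_eq_norm, sub_neg_eq_add, h1, norm_eq_sq hδ]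
  linear_combination h2

/-- Links the focal equation 2|z² - Δ| = 2|z|² - M, once squared, to the polynomial one. -/
lemma sq_norm_sq_sub :
    4 * ‖z ^ 2 - Δ‖ ^ 2 = (2 * ‖z‖ ^ 2 - M) ^ 2 - conicValue Δ M z := by
  have h : ∀ w : ℂ, ‖w‖ ^ 2 = w.re ^ 2 + w.im ^ 2 := fun w => by
    rw [Complex.sq_norm, Complex.normSq_apply]; ring
  simp only [conicValue, h, Complex.mul_re, Complex.conj_re, Complex.conj_im, Complex.sub_re,
    Complex.sub_im, pow_two z, Complex.mul_im]
  ring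

/-- Makes the squaring of the focal equation reversible: Re(conj Δ z²) ≤ |Δ||z|² forces 4|z|² ≥ 2|Δ|
+ M, which exceeds 2M. -/
lemma le_two_mul_sq_norm (h₁ : M < 2 * ‖Δ‖) (h : 0 ≤ conicValue Δ M z) :
    0 < 2 * ‖z‖ ^ 2 - M := by
  have h3 : (starRingEnd ℂ Δ * z ^ 2).re ≤ ‖Δ‖ * ‖z‖ ^ 2 := by
    refine (Complex.re_le_norm _).trans ?_
    simp
  unfold conicValue at h
  have : (2 * ‖Δ‖ - M) * (2 * ‖Δ‖ + M) ≤ (2 * ‖Δ‖ - M) * (4 * ‖z‖ ^ 2) := by nlinarith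
  have := le_of_mul_le_mul_left this (by linarith)
  linarith

lemma mem_hyperbolicDisc_iff_norm_le (hδ : δ ^ 2 = Δ) (hl : l = Real.sqrt (2 * ‖Δ‖ - M))
    (h₁ : M ≤ 2 * ‖Δ‖) (h₂ : -M ≤ 2 * ‖Δ‖) :
    z ∈ hyperbolicDisc δ (-δ) l ↔ 2 * ‖z ^ 2 - Δ‖ ≤ 2 * ‖z‖ ^ 2 - M := by
  change transverseLength δ (-δ) l ≤ _ ↔ _
  rw [← sq_le_sq₀ (transverseLength_nonneg _ _ _) (abs_nonneg _), sq_abs,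
    sq_transverseLength hδ hl h₁ h₂, sq_dist_sub_dist hδ]
  constructor <;> intro h <;> linarith

lemma mem_hyperbolicDisc_iff (hδ : δ ^ 2 = Δ) (hl : l = Real.sqrt (2 * ‖Δ‖ - M))
    (h₁ : M < 2 * ‖Δ‖) (h₂ : -M ≤ 2 * ‖Δ‖) :
    z ∈ hyperbolicDisc δ (-δ) l ↔ 0 ≤ conicValue Δ M z := by
  rw [mem_hyperbolicDisc_iff_norm_le hδ hl h₁.le h₂]
  have h := sq_norm_sq_sub (Δ := Δ) (M := M) (z := z)
  constructor
  · intro h4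
    have := pow_le_pow_left₀ (by positivity) h4 2
    linarith
  · intro h4
    have := le_two_mul_sq_norm h₁ h4
    rw [← sq_le_sq₀ (by positivity) this.le]
    linarith

lemma mem_hyperbola_iff (hδ : δ ^ 2 = Δ) (hl : l = Real.sqrt (2 * ‖Δ‖ - M))
    (h₁ : M < 2 * ‖Δ‖) (h₂ : -M ≤ 2 * ‖Δ‖) :
    z ∈ hyperbola δ (-δ) l ↔ conicValue Δ M z = 0 := by
  have h := sq_norm_sq_sub (Δ := Δ) (M := M) (z := z)
  have h3 : z ∈ hyperbola δ (-δ) l ↔ 2 * ‖z ^ 2 - Δ‖ = 2 * ‖z‖ ^ 2 - M := by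
    change _ = transverseLength δ (-δ) l ↔ _
    rw [← sq_eq_sq₀ (abs_nonneg _) (transverseLength_nonneg _ _ _), sq_abs,
      sq_dist_sub_dist hδ, sq_transverseLength hδ hl h₁.le h₂]
    constructor <;> intro h <;> linarith
  rw [h3]
  constructor
  · intro h4
    rw [← h4] at h
    linarith
  · intro h4
    have := le_two_mul_sq_norm h₁ h4.ge
    rw [← sq_eq_sq₀ (by positivity) this.le]
    linarith

lemma frontier_hyperbolicDisc (hδ : δ ^ 2 = Δ) (hl : l = Real.sqrt (2 * ‖Δ‖ - M))
    (h₁ : M < 2 * ‖Δ‖) (h₂ : -M < 2 * ‖Δ‖) :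
    frontier (hyperbolicDisc δ (-δ) l) = hyperbola δ (-δ) l := by
  have hd : hyperbolicDisc δ (-δ) l = {z | 0 ≤ conicValue Δ M z} := by
    ext z; exact mem_hyperbolicDisc_iff hδ hl h₁ h₂.le
  ext z
  rw [mem_hyperbola_iff hδ hl h₁ h₂.le, hd]
  constructor
  · intro h
    exact (frontier_le_subset_eq continuous_const (continuous_conicValue Δ M) h).symm
  · intro h
    rw [frontier_eq_closure_inter_closure]
    refine ⟨subset_closure h.ge, ?_⟩
    have hpos : 0 < 4 * ‖Δ‖ ^ 2 - M ^ 2 := by nlinarith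
    -- Up to its constant term the equation is homogeneous of degree 2, so shrinking a point of the
    -- hyperbola towards the centre leaves the disc; hence each such point is a limit of exterior
    -- points.
    have hval (s : ℝ) : conicValue Δ M (s * z) = (s ^ 2 - 1) * (4 * ‖Δ‖ ^ 2 - M ^ 2) := by
      have : conicValue Δ M (s * z)
          = s ^ 2 * (conicValue Δ M z + (4 * ‖Δ‖ ^ 2 - M ^ 2)) - (4 * ‖Δ‖ ^ 2 - M ^ 2) := by
        have h5 : starRingEnd ℂ Δ * (s * z) ^ 2 = ((s ^ 2 : ℝ) : ℂ) * (starRingEnd ℂ Δ * z ^ 2) := by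
          push_cast; ring
        simp only [conicValue, h5, Complex.re_ofReal_mul]
        simp only [norm_mul, mul_pow, Complex.norm_real, Real.norm_eq_abs, sq_abs]
        ring
      rw [this, h]; ring
    have hlim : Filter.Tendsto (fun s : ℝ => (s : ℂ) * z) (nhdsWithin 1 (Set.Iio 1)) (nhds z) := by
      have : Continuous fun s : ℝ => (s : ℂ) * z := by fun_prop
      have := (this.tendsto 1).mono_left (nhdsWithin_le_nhds (s := Set.Iio 1))
      simpa using this
    refine mem_closure_of_tendsto hlim ?_
    have h0 : Set.Ioo (0 : ℝ) 1 ∈ nhdsWithin (1 : ℝ) (Set.Iio 1) :=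
      Ioo_mem_nhdsLT zero_lt_one
    filter_upwards [h0] with s hs
    simp only [Set.mem_compl_iff, Set.mem_ofPred_eq, not_le, hval]
    exact mul_neg_of_neg_of_pos (by nlinarith [hs.1, hs.2]) hpos

lemma isNondegenerateHyperbola_iff (hδ : δ ^ 2 = Δ) (hl : l = Real.sqrt (2 * ‖Δ‖ - M)) :
    IsNondegenerateHyperbola δ (-δ) l ↔ |M| < 2 * ‖Δ‖ := by
  rw [IsNondegenerateHyperbola, hl, Real.sqrt_pos, dist_focus_neg, abs_lt]
  constructor
  · rintro ⟨h1, h2⟩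
    have := (Real.sqrt_lt' ((Real.sqrt_nonneg _).trans_lt h2)).1 h2
    rw [mul_pow, ← norm_eq_sq hδ] at this
    constructor <;> linarith
  · rintro ⟨h1, h2⟩
    have h0 : 0 < ‖Δ‖ := by linarith
    have : 0 < ‖δ‖ := by
      rw [norm_eq_sq hδ] at h0
      exact norm_pos_iff.2 (by rintro rfl; simp at h0)
    refine ⟨by linarith, (Real.sqrt_lt' (by positivity)).2 ?_⟩
    rw [mul_pow, ← norm_eq_sq hδ]
    linarith

end Hyperbola

/-! ### The numerical range as a set of quotients -/

section Range

variable {n : Type} [Fintype n]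

lemma indefInner_smul_self (J B : Matrix n n ℂ) (c : ℂ) (x : n → ℂ) :
    indefInner J (B *ᵥ (c • x)) (c • x) = ((‖c‖ ^ 2 : ℝ) : ℂ) * indefInner J (B *ᵥ x) x := by
  simp only [indefInner, mulVec_smul, star_smul, smul_dotProduct, dotProduct_smul, smul_eq_mul]
  rw [← mul_assoc, Complex.ofReal_pow, ← Complex.mul_conj' c]
  rfl

/-- The Krein space numerical range consists of the quotients `[Ax, x] / [x, x]`, the form
`[x, x]` being real. -/
lemma mem_knr_iff [DecidableEq n] {J A : Matrix n n ℂ} (hJ : ∀ x, ((indefInner J x x).re : ℂ) = indefInner J x x)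
    {z : ℂ} :
    z ∈ knr J A ↔
      ∃ x, indefInner J x x ≠ 0 ∧ indefInner J (A *ᵥ x) x = z * indefInner J x x := by
  constructor
  · rintro (⟨x, h1, h2⟩ | ⟨x, h1, h2⟩)
    · exact ⟨x, by simp [h1], by simp [h1, h2]⟩
    · exact ⟨x, by simp [h1], by simp [h1, h2]⟩
  · rintro ⟨x, h1, h2⟩
    obtain ⟨N, hN⟩ : ∃ N : ℝ, (N : ℂ) = indefInner J x x := ⟨_, hJ x⟩
    rw [← hN] at h1 h2
    have hN0 : N ≠ 0 := by exact_mod_cast h1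
    set c : ℂ := (((Real.sqrt |N|)⁻¹ : ℝ) : ℂ) with hc
    have hcn : ‖c‖ ^ 2 = |N|⁻¹ := by
      rw [hc, Complex.norm_real, Real.norm_eq_abs, sq_abs, inv_pow, Real.sq_sqrt (abs_nonneg _)]
    have e1 := indefInner_smul_self J 1 c x
    have e2 := indefInner_smul_self J A c x
    rw [one_mulVec, one_mulVec, hcn, ← hN] at e1
    rw [hcn, h2] at e2
    rcases lt_or_gt_of_ne hN0 with h | h
    · rw [abs_of_neg h] at e1 e2
      refine Or.inl ⟨c • x, ?_, ?_⟩
      · rw [e1]; push_cast; field_simp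
      · rw [e2]; push_cast; field_simp
    · rw [abs_of_pos h] at e1 e2
      refine Or.inr ⟨c • x, ?_, ?_⟩
      · rw [e1]; push_cast; field_simp
      · rw [e2]; push_cast; field_simp

end Range

/-! ### Two inequalities for quadratic forms -/

/-- A nonnegative real quadratic form `Re(ζ² D) + |ζ|² E` on `ℂ` has `|D| ≤ E`. -/
lemma norm_le_of_forall_re_nonneg {D : ℂ} {E : ℝ}
    (h : ∀ ζ : ℂ, 0 ≤ (ζ ^ 2 * D).re + ‖ζ‖ ^ 2 * E) : ‖D‖ ≤ E := by
  rcases eq_or_ne D 0 with rfl | hD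
  · simpa using h 1
  -- The direction that minimizes the form: ζ²D = -|D|² with |ζ|² = |D|.
  obtain ⟨ζ, hζ⟩ := IsAlgClosed.exists_pow_nat_eq (-(starRingEnd ℂ D)) zero_lt_two
  have hn : ‖ζ‖ ^ 2 = ‖D‖ := by rw [← norm_pow, hζ]; simp
  have h1 := h ζ
  have h2 : ζ ^ 2 * D = ((-‖D‖ ^ 2 : ℝ) : ℂ) := by
    rw [hζ, neg_mul, Complex.conj_mul']; push_cast; ring
  rw [h2, Complex.ofReal_re, hn] at h1
  have h3 : ‖D‖ * ‖D‖ ≤ ‖D‖ * E := by linarith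
  exact le_of_mul_le_mul_left h3 (norm_pos_iff.2 hD)

/-- The reverse Cauchy-Schwarz estimate for a form `c (m² + n²) + t` with `|t| ≤ 2 σ m n`. -/
lemma sq_sub_sq_mul_sq_le {c S t P R : ℝ} (hS : 0 ≤ S) (hP : 0 ≤ P) (hR : 0 ≤ R)
    (ht : t ^ 2 ≤ 4 * S * (P * R)) :
    (c ^ 2 - S) * (P - R) ^ 2 ≤ (c * (P + R) + t) ^ 2 := by
  rcases le_total (c ^ 2) S with h | h
  · exact (mul_nonpos_of_nonpos_of_nonneg (by linarith) (sq_nonneg _)).trans (sq_nonneg _)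
  set σ := Real.sqrt S
  set m := Real.sqrt P
  set n := Real.sqrt R
  have hσ : σ ^ 2 = S := Real.sq_sqrt hS
  have hm : m ^ 2 = P := Real.sq_sqrt hP
  have hn : n ^ 2 = R := Real.sq_sqrt hR
  have p1 : 0 ≤ σ := Real.sqrt_nonneg _
  have p2 : 0 ≤ m := Real.sqrt_nonneg _
  have p3 : 0 ≤ n := Real.sqrt_nonneg _
  have t1 : |t| ≤ 2 * σ * (m * n) := by
    refine abs_le_of_sq_le_sq ?_ (by positivity)
    rw [← hσ, ← hm, ← hn] at ht
    linarith
  have c1 : σ ≤ |c| := by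
    rw [← sq_le_sq₀ p1 (abs_nonneg c), sq_abs, hσ]; exact h
  have h2 : 2 * σ * (m * n) ≤ |c| * (P + R) := by
    have : 2 * (m * n) ≤ P + R := by nlinarith [sq_nonneg (m - n)]
    nlinarith [mul_nonneg p2 p3, abs_nonneg c]
  have h3 : |c| * (P + R) - |t| ≤ |c * (P + R) + t| := by
    have := abs_sub_abs_le_abs_sub (c * (P + R)) (-t)
    rwa [abs_neg, sub_neg_eq_add, abs_mul, abs_of_nonneg (add_nonneg hP hR)] at this
  have h4 : (|c| * (P + R) - 2 * σ * (m * n)) ^ 2 ≤ (c * (P + R) + t) ^ 2 := by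
    rw [← sq_abs (c * (P + R) + t)]
    exact pow_le_pow_left₀ (by linarith) (by linarith) 2
  refine le_trans ?_ h4
  -- Since (m² + n²)² = (m² - n²)² + 4m²n², the difference is a perfect square.
  have : (|c| * (P + R) - 2 * σ * (m * n)) ^ 2 - (c ^ 2 - S) * (P - R) ^ 2
      = (|c| * (2 * (m * n)) - σ * (P + R)) ^ 2 := by
    rw [← hσ, ← hm, ← hn, ← sq_abs c]; ring
  linarith [sq_nonneg (|c| * (2 * (m * n)) - σ * (P + R))]

/-! ### The numerical range lies in the disc -/

section Centrosymmetric

open ComplexConjugate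

/-- The matrix `diag(1, -1, 1, -1, 1)`. -/
def signature5 : Matrix (Fin 5) (Fin 5) ℂ := diagonal ![1, -1, 1, -1, 1]

/-- The centrosymmetric tridiagonal matrix of order `5` with biperiodic main diagonal
`(a, -a, a, -a, a)`. -/
def centro5 (a : ℝ) (b₁ b₂ b₃ b₄ : ℂ) : Matrix (Fin 5) (Fin 5) ℂ :=
  tridiag5 ![b₄, b₃, b₂, b₁] ![(a : ℂ), -(a : ℂ), (a : ℂ), -(a : ℂ), (a : ℂ)] ![b₁, b₂, b₃, b₄]

variable {a : ℝ} {b₁ b₂ b₃ b₄ : ℂ}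

lemma indefInner_signature5_self (x : Fin 5 → ℂ) :
    indefInner signature5 x x =
      (((‖x 0‖ ^ 2 + ‖x 2‖ ^ 2 + ‖x 4‖ ^ 2) - (‖x 1‖ ^ 2 + ‖x 3‖ ^ 2) : ℝ) : ℂ) := by
  simp only [indefInner, signature5, dotProduct, mulVec_diagonal, Fin.sum_univ_five, Pi.star_apply,
    RCLike.star_def]
  push_cast
  simp only [← Complex.conj_mul']
  simp
  ring

lemma indefInner_centro5 (x : Fin 5 → ℂ) :
    indefInner signature5 (centro5 a b₁ b₂ b₃ b₄ *ᵥ x) x =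
      a * ((‖x 0‖ ^ 2 + ‖x 2‖ ^ 2 + ‖x 4‖ ^ 2) + (‖x 1‖ ^ 2 + ‖x 3‖ ^ 2) : ℝ)
        + (b₁ * (conj (x 0) * x 1 + conj (x 4) * x 3) - b₄ * (x 0 * conj (x 1) + x 4 * conj (x 3))
          + b₃ * (conj (x 2) * x 1 + conj (x 2) * x 3)
          - b₂ * (x 2 * conj (x 1) + x 2 * conj (x 3))) := by
  simp only [indefInner, signature5, dotProduct, Fin.sum_univ_five, Pi.star_apply,
    RCLike.star_def, centro5, tridiag5, mulVec]
  push_cast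
  simp only [← Complex.conj_mul']
  simp
  ring

lemma indefInner_signature5_re (x : Fin 5 → ℂ) :
    ((indefInner signature5 x x).re : ℂ) = indefInner signature5 x x := by
  rw [indefInner_signature5_self, Complex.ofReal_re]

/-- The block with rows (g, 0), (h, h), (0, g) has squared operator norm |g|² + 2|h|², reached at y₁
= y₂. -/
lemma mul_conj_add_mul_sq_le (g h y₁ y₂ v₀ v₂ v₄ : ℂ) :
    (2 * (conj v₀ * (g * y₁) + conj v₂ * (h * (y₁ + y₂)) + conj v₄ * (g * y₂)).re) ^ 2 ≤
      4 * (‖g‖ ^ 2 + 2 * ‖h‖ ^ 2) *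
        ((‖v₀‖ ^ 2 + ‖v₂‖ ^ 2 + ‖v₄‖ ^ 2) * (‖y₁‖ ^ 2 + ‖y₂‖ ^ 2)) := by
  set P := ‖v₀‖ ^ 2 + ‖v₂‖ ^ 2 + ‖v₄‖ ^ 2
  have hcs : (conj v₀ * (g * y₁) + conj v₂ * (h * (y₁ + y₂)) + conj v₄ * (g * y₂)).re ^ 2 ≤
      P * (‖g * y₁‖ ^ 2 + ‖h * (y₁ + y₂)‖ ^ 2 + ‖g * y₂‖ ^ 2) := by
    have h1 (s t : ℂ) : |(conj s * t).re| ≤ ‖s‖ * ‖t‖ := by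
      simpa using Complex.abs_re_le_norm (conj s * t)
    have h2 : |(conj v₀ * (g * y₁) + conj v₂ * (h * (y₁ + y₂)) + conj v₄ * (g * y₂)).re| ≤
        ‖v₀‖ * ‖g * y₁‖ + ‖v₂‖ * ‖h * (y₁ + y₂)‖ + ‖v₄‖ * ‖g * y₂‖ := by
      rw [Complex.add_re, Complex.add_re]
      exact (abs_add_three _ _ _).trans (add_le_add_three (h1 _ _) (h1 _ _) (h1 _ _))
    rw [← sq_abs]
    refine (pow_le_pow_left₀ (abs_nonneg _) h2 2).trans ?_
    nlinarith [sq_nonneg (‖v₀‖ * ‖h * (y₁ + y₂)‖ - ‖v₂‖ * ‖g * y₁‖),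
      sq_nonneg (‖v₀‖ * ‖g * y₂‖ - ‖v₄‖ * ‖g * y₁‖),
      sq_nonneg (‖v₂‖ * ‖g * y₂‖ - ‖v₄‖ * ‖h * (y₁ + y₂)‖)]
  have hy : ‖y₁ + y₂‖ ^ 2 ≤ 2 * (‖y₁‖ ^ 2 + ‖y₂‖ ^ 2) := by
    have := parallelogram_law_with_norm ℝ y₁ y₂
    nlinarith [sq_nonneg ‖y₁ - y₂‖]
  have h2 : ‖g * y₁‖ ^ 2 + ‖h * (y₁ + y₂)‖ ^ 2 + ‖g * y₂‖ ^ 2 ≤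
      (‖g‖ ^ 2 + 2 * ‖h‖ ^ 2) * (‖y₁‖ ^ 2 + ‖y₂‖ ^ 2) := by
    simp only [norm_mul, mul_pow]
    nlinarith [mul_le_mul_of_nonneg_left hy (sq_nonneg ‖h‖)]
  have hP : 0 ≤ P := by positivity
  have := mul_le_mul_of_nonneg_left h2 hP
  linarith

/-- The off-diagonal entry of `Re^J (ζ A)`. -/
noncomputable def offDiag (b c ζ : ℂ) : ℂ := (ζ * b - conj ζ * conj c) / 2

/-- Two expressions for the least of the squares of the eigenvalues of `Re^J (ζ A)`. -/
lemma sq_re_sub_offDiag {Δ : ℂ} {M : ℝ}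
    (hΔ : Δ = (a : ℂ) ^ 2 + b₁ * b₄ + 2 * b₂ * b₃)
    (hM : M = 2 * a ^ 2 - ‖b₁‖ ^ 2 - ‖b₄‖ ^ 2 - 2 * ‖b₂‖ ^ 2 - 2 * ‖b₃‖ ^ 2) (ζ : ℂ) :
    (a * ζ.re) ^ 2 - (‖offDiag b₁ b₄ ζ‖ ^ 2 + 2 * ‖offDiag b₃ b₂ ζ‖ ^ 2) =
      ((ζ ^ 2 * Δ).re + ‖ζ‖ ^ 2 * (M / 2)) / 2 := by
  have h : ∀ w : ℂ, ‖w‖ ^ 2 = w.re ^ 2 + w.im ^ 2 := fun w => by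
    rw [Complex.sq_norm, Complex.normSq_apply]; ring
  subst hΔ hM
  simp only [offDiag, h]
  simp [pow_two]
  ring

/-- Each ζ gives one inequality, the reverse Cauchy-Schwarz bound for Re^J(ζA). Together they say
that a real quadratic form in ζ is nonnegative, and that is a bound on |z² - Δ|. -/
lemma knr_centro5_subset {Δ : ℂ} {M : ℝ}
    (hΔ : Δ = (a : ℂ) ^ 2 + b₁ * b₄ + 2 * b₂ * b₃)
    (hM : M = 2 * a ^ 2 - ‖b₁‖ ^ 2 - ‖b₄‖ ^ 2 - 2 * ‖b₂‖ ^ 2 - 2 * ‖b₃‖ ^ 2) {z : ℂ}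
    (hz : z ∈ knr signature5 (centro5 a b₁ b₂ b₃ b₄)) :
    2 * ‖z ^ 2 - Δ‖ ≤ 2 * ‖z‖ ^ 2 - M := by
  obtain ⟨x, hx, hxz⟩ := (mem_knr_iff indefInner_signature5_re).1 hz
  rw [indefInner_signature5_self] at hx hxz
  rw [indefInner_centro5] at hxz
  set P := ‖x 0‖ ^ 2 + ‖x 2‖ ^ 2 + ‖x 4‖ ^ 2
  set R := ‖x 1‖ ^ 2 + ‖x 3‖ ^ 2
  have hPR : P - R ≠ 0 := by exact_mod_cast hx
  have key (ζ : ℂ) : ((ζ ^ 2 * Δ).re + ‖ζ‖ ^ 2 * (M / 2)) / 2 ≤ (ζ * z).re ^ 2 := by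
    have h1 := mul_conj_add_mul_sq_le (offDiag b₁ b₄ ζ) (offDiag b₃ b₂ ζ) (x 1) (x 3) (x 0) (x 2)
      (x 4)
    have h2 := sq_sub_sq_mul_sq_le (c := a * ζ.re) (by positivity) (by positivity) (by positivity) h1
    rw [sq_re_sub_offDiag hΔ hM] at h2
    have h3 : (ζ * z).re * (P - R) = a * ζ.re * (P + R) +
        2 * (conj (x 0) * (offDiag b₁ b₄ ζ * x 1) + conj (x 2) * (offDiag b₃ b₂ ζ * (x 1 + x 3))
          + conj (x 4) * (offDiag b₁ b₄ ζ * x 3)).re := by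
      rw [← Complex.re_mul_ofReal, mul_assoc, ← hxz]
      simp [offDiag]
      ring
    rw [← h3, mul_pow] at h2
    exact le_of_mul_le_mul_right h2 (by positivity)
  have h4 := norm_le_of_forall_re_nonneg (D := z ^ 2 - Δ) (E := ‖z‖ ^ 2 - M / 2) fun ζ => by
    have h5 : (ζ ^ 2 * (z ^ 2 - Δ)).re = (ζ ^ 2 * z ^ 2).re - (ζ ^ 2 * Δ).re := by
      rw [mul_sub, Complex.sub_re]
    have h6 : 2 * (ζ * z).re ^ 2 = (ζ ^ 2 * z ^ 2).re + ‖ζ‖ ^ 2 * ‖z‖ ^ 2 := by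
      rw [← mul_pow, ← mul_pow, ← norm_mul, Complex.sq_norm, Complex.normSq_apply, pow_two (ζ * z),
        Complex.mul_re (ζ * z)]
      ring
    linarith [key ζ]
  linarith

/-! ### The disc lies in the numerical range -/

/-- A real-linear map `ℂ² → ℂ` takes its value at a point also at points of larger norm, for a
positive definite form `2 |p|² + |q|²`. -/
lemma exists_norm_eq_of_linearMap (f : ℂ × ℂ →ₗ[ℝ] ℂ) (v : ℂ × ℂ) {T : ℝ}
    (hv : 2 * ‖v.1‖ ^ 2 + ‖v.2‖ ^ 2 ≤ T) :
    ∃ w, f w = f v ∧ 2 * ‖w.1‖ ^ 2 + ‖w.2‖ ^ 2 = T := by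
  -- The kernel is nonzero because the real dimension drops from 4 to 2. Moving along it changes the
  -- norm only; the required step solves a quadratic whose constant term is nonpositive.
  obtain ⟨k, hk, hk0⟩ : ∃ k ∈ LinearMap.ker f, k ≠ 0 := by
    refine (Submodule.ne_bot_iff _).1 (LinearMap.ker_ne_bot_of_finrank_lt ?_)
    simp [Complex.finrank_real_complex]
  set α := 2 * ‖k.1‖ ^ 2 + ‖k.2‖ ^ 2
  set β := 2 * (2 * (v.1 * conj k.1).re + (v.2 * conj k.2).re)
  have hα : 0 < α := by
    rcases eq_or_ne k.1 0 with h | h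
    · have : k.2 ≠ 0 := fun h' => hk0 (Prod.ext h h')
      positivity
    · positivity
  have hdisc : 0 ≤ discrim α β (2 * ‖v.1‖ ^ 2 + ‖v.2‖ ^ 2 - T) := by
    unfold discrim
    nlinarith [sq_nonneg β]
  obtain ⟨s, hs⟩ := exists_quadratic_eq_zero hα.ne' ⟨_, (Real.mul_self_sqrt hdisc).symm⟩
  refine ⟨v + s • k, by rw [map_add, map_smul, LinearMap.mem_ker.1 hk, smul_zero, add_zero], ?_⟩
  have hn (c d : ℂ) : ‖c + s • d‖ ^ 2 = ‖c‖ ^ 2 + 2 * s * (c * conj d).re + s ^ 2 * ‖d‖ ^ 2 := by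
    simp only [Complex.sq_norm, Complex.normSq_apply]
    simp
    ring
  rw [Prod.fst_add, Prod.snd_add, Prod.smul_fst, Prod.smul_snd, hn, hn]
  linear_combination hs

/-- The real-linear map giving the off-diagonal contribution to `[Ax, x]` for symmetric vectors. -/
noncomputable def offDiagMap (b₁ b₂ b₃ b₄ : ℂ) : ℂ × ℂ →ₗ[ℝ] ℂ where
  toFun v := b₁ * conj v.1 - b₄ * v.1 - b₂ * v.2 + b₃ * conj v.2
  map_add' v w := by simp; ring
  map_smul' s v := by simp; ring

/-- For x = (v₁, r, v₂, r, v₁) with r = (C - 1)/2, the norm condition gives [x, x] = C - 1 and |x|²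
= C(C - 1). The quotient of the diagonal part is then aC, and the factor 2r of the off-diagonal part
cancels [x, x]. -/
lemma mem_knr_centro5_of_norm_eq {z : ℂ} {C : ℝ} {v : ℂ × ℂ} (hC : C ≠ 1)
    (hv : 2 * ‖v.1‖ ^ 2 + ‖v.2‖ ^ 2 = (C ^ 2 - 1) / 2)
    (hz : z = a * C + offDiagMap b₁ b₂ b₃ b₄ v) :
    z ∈ knr signature5 (centro5 a b₁ b₂ b₃ b₄) := by
  rw [mem_knr_iff indefInner_signature5_re]
  set r : ℂ := (((C - 1) / 2 : ℝ) : ℂ) with hr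
  have hrn : ‖r‖ ^ 2 = ((C - 1) / 2) ^ 2 := by
    rw [hr, Complex.norm_real, Real.norm_eq_abs, sq_abs]
  have hrc : conj r = r := Complex.conj_ofReal _
  have e1 : (‖v.1‖ ^ 2 + ‖v.2‖ ^ 2 + ‖v.1‖ ^ 2) - (‖r‖ ^ 2 + ‖r‖ ^ 2) = C - 1 := by
    rw [hrn]; linear_combination hv
  have e2 : (‖v.1‖ ^ 2 + ‖v.2‖ ^ 2 + ‖v.1‖ ^ 2) + (‖r‖ ^ 2 + ‖r‖ ^ 2) = C * (C - 1) := by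
    rw [hrn]; linear_combination hv
  refine ⟨![v.1, r, v.2, r, v.1], ?_⟩
  rw [indefInner_signature5_self, indefInner_centro5]
  simp only [Matrix.cons_val, e1, e2, hrc]
  refine ⟨by exact_mod_cast sub_ne_zero.2 hC, ?_⟩
  rw [hz, hr]
  simp only [offDiagMap, LinearMap.coe_mk, AddHom.coe_mk]
  push_cast
  ring

lemma self_mem_knr_centro5 : (a : ℂ) ∈ knr signature5 (centro5 a b₁ b₂ b₃ b₄) := by
  rw [mem_knr_iff indefInner_signature5_re]
  refine ⟨![1, 0, 0, 0, 0], ?_⟩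
  rw [indefInner_signature5_self, indefInner_centro5]
  simp

/-- With C = a Re k, the condition on k reads C² - S ≥ 1, so the pair v below is short enough to be
lengthened, without changing its image, to the norm required by `mem_knr_centro5_of_norm_eq`. -/
lemma mem_knr_centro5_of_dual {Δ : ℂ} {M : ℝ}
    (hΔ : Δ = (a : ℂ) ^ 2 + b₁ * b₄ + 2 * b₂ * b₃)
    (hM : M = 2 * a ^ 2 - ‖b₁‖ ^ 2 - ‖b₄‖ ^ 2 - 2 * ‖b₂‖ ^ 2 - 2 * ‖b₃‖ ^ 2) {z k : ℂ}
    (hz : z = k * Δ / 2 + conj k * (M / 4))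
    (hk : 1 ≤ ((k ^ 2 * Δ).re + ‖k‖ ^ 2 * (M / 2)) / 2) :
    z ∈ knr signature5 (centro5 a b₁ b₂ b₃ b₄) := by
  rw [← sq_re_sub_offDiag hΔ hM] at hk
  -- Minus half the adjoint of `offDiagMap` applied to k, for the pairing Re(kz) and the form 2|p|²
  -- + |q|²; it is thus the shortest preimage of its image.
  set v : ℂ × ℂ := (-offDiag b₁ b₄ k / 2, -offDiag b₃ b₂ k)
  have hzv : z = a * ((a * k.re : ℝ) : ℂ) + offDiagMap b₁ b₂ b₃ b₄ v := by
    have h2c : conj (2 : ℂ) = 2 := map_ofNat _ 2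
    rw [hz, hΔ, hM]
    push_cast
    simp only [← Complex.conj_mul', Complex.re_eq_add_conj, offDiagMap, LinearMap.coe_mk,
      AddHom.coe_mk, v, offDiag]
    simp [h2c]
    ring
  have hvn : 2 * ‖v.1‖ ^ 2 + ‖v.2‖ ^ 2 =
      (‖offDiag b₁ b₄ k‖ ^ 2 + 2 * ‖offDiag b₃ b₂ k‖ ^ 2) / 2 := by
    simp [v]
    ring
  -- At C = 1 the symmetric vector would be null; there S = 0, hence z = a, which is attained at the
  -- first basis vector.
  rcases eq_or_ne (a * k.re) 1 with hC | hC
  · rw [hC] at hk hzv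
    have h1 : ‖offDiag b₁ b₄ k‖ ^ 2 = 0 :=
      le_antisymm (by nlinarith [sq_nonneg ‖offDiag b₃ b₂ k‖]) (sq_nonneg _)
    have h2 : ‖offDiag b₃ b₂ k‖ ^ 2 = 0 :=
      le_antisymm (by nlinarith [sq_nonneg ‖offDiag b₃ b₂ k‖]) (sq_nonneg _)
    have hv : v = 0 := by
      rw [sq_eq_zero_iff, norm_eq_zero] at h1 h2
      simp [v, h1, h2]
    rw [hzv, hv, map_zero, Complex.ofReal_one, mul_one, add_zero]
    exact self_mem_knr_centro5
  · obtain ⟨w, hw1, hw2⟩ := exists_norm_eq_of_linearMap (offDiagMap b₁ b₂ b₃ b₄) v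
      (T := ((a * k.re) ^ 2 - 1) / 2) (by rw [hvn]; linarith)
    exact mem_knr_centro5_of_norm_eq hC hw2 (by rw [hzv, hw1])

lemma mem_knr_centro5_of_conicValue {Δ : ℂ} {M : ℝ}
    (hΔ : Δ = (a : ℂ) ^ 2 + b₁ * b₄ + 2 * b₂ * b₃)
    (hM : M = 2 * a ^ 2 - ‖b₁‖ ^ 2 - ‖b₄‖ ^ 2 - 2 * ‖b₂‖ ^ 2 - 2 * ‖b₃‖ ^ 2)
    (h : |M| < 2 * ‖Δ‖) {z : ℂ} (hz : 0 ≤ conicValue Δ M z) :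
    z ∈ knr signature5 (centro5 a b₁ b₂ b₃ b₄) := by
  set d : ℝ := 4 * ‖Δ‖ ^ 2 - M ^ 2 with hd
  have hd0 : 0 < d := by
    have := pow_lt_pow_left₀ h (abs_nonneg M) two_ne_zero
    rw [sq_abs] at this
    linarith
  have hdc : (d : ℂ) = 4 * (conj Δ * Δ) - M ^ 2 := by
    rw [Complex.conj_mul', hd]; push_cast; ring
  have hdc0 : (d : ℂ) ≠ 0 := by exact_mod_cast hd0.ne'
  -- The solution of z = kΔ/2 + conj(k)M/4, by Cramer's rule for this equation and its conjugate.
  set k : ℂ := (8 * conj Δ * z - 4 * M * conj z) / d with hk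
  have hkz : z = k * Δ / 2 + conj k * (M / 4) := by
    rw [hk]
    simp only [map_div₀, map_sub, map_mul, Complex.conj_conj, Complex.conj_ofReal, map_ofNat]
    field_simp
    rw [hdc]
    ring
  refine mem_knr_centro5_of_dual hΔ hM hkz ?_
  have h1 : ((k ^ 2 * Δ).re + ‖k‖ ^ 2 * (M / 2)) / 2 = (k * z).re := by
    rw [← Complex.ofReal_re (‖k‖ ^ 2 * (M / 2)), ← Complex.add_re]
    push_cast
    rw [← Complex.conj_mul']
    have : k * z = (k ^ 2 * Δ + conj k * k * (M / 2)) / 2 := by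
      conv_lhs => rw [hkz]
      ring
    rw [this, Complex.div_ofNat_re]
  have h2 : k * z = (8 * (conj Δ * z ^ 2) - ((4 * M * ‖z‖ ^ 2 : ℝ) : ℂ)) / d := by
    rw [hk]; push_cast; rw [← Complex.conj_mul']; ring
  rw [h1, h2, Complex.div_ofReal_re, Complex.sub_re, Complex.ofReal_re, one_le_div hd0]
  have h3 : (8 * (conj Δ * z ^ 2)).re = 8 * (conj Δ * z ^ 2).re := by
    simp
  rw [h3]
  unfold conicValue at hz
  linarith

end Centrosymmetric

/-! ### Dual curves of lines and conics -/

section Curve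

open MvPolynomial ComplexConjugate

/-- The homogeneous coordinates `[x : y : 1]` of a point of the plane. -/
noncomputable def homogCoords (z : ℂ) : Fin 3 → ℂ := ![(z.re : ℂ), (z.im : ℂ), 1]

/-- The real affine points of the union of the dual curves of the irreducible components of
`F = 0`. -/
def dualCurve (F : MvPolynomial (Fin 3) ℂ) : Set ℂ :=
  {z | ∃ G : MvPolynomial (Fin 3) ℂ, Irreducible G ∧ G ∣ F ∧ homogCoords z ∈ dualCone G}

lemma boundaryCurve_eq_dualCurve {n : Type} [Fintype n] [DecidableEq n] (J A : Matrix n n ℂ) :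
    boundaryCurve J A = dualCurve (lineForm J A) := rfl

lemma dualCurve_mul (F G : MvPolynomial (Fin 3) ℂ) :
    dualCurve (F * G) = dualCurve F ∪ dualCurve G := by
  ext z
  constructor
  · rintro ⟨K, hK, hd, hz⟩
    rcases hK.prime.dvd_or_dvd hd with h | h
    · exact Or.inl ⟨K, hK, h, hz⟩
    · exact Or.inr ⟨K, hK, h, hz⟩
  · rintro (⟨K, hK, h, hz⟩ | ⟨K, hK, h, hz⟩)
    · exact ⟨K, hK, h.mul_right G, hz⟩
    · exact ⟨K, hK, h.mul_left F, hz⟩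

lemma dualCone_subset_mul_C (G : MvPolynomial (Fin 3) ℂ) {c : ℂ} (hc : c ≠ 0) :
    dualCone (G * C c) ⊆ dualCone G := by
  intro q hq P hP
  refine hq P fun p t hp => ?_
  have : t • grad (G * C c) p = (t * c) • grad G p := by
    ext i
    simp [grad]
    ring
  rw [this]
  refine hP p _ ?_
  rw [eval_mul, eval_C] at hp
  exact (mul_eq_zero.1 hp).resolve_right hc

/-- An irreducible divisor of G is a constant multiple of G, and the constant is absorbed by the
cone parameter t. -/
lemma dualCurve_of_irreducible {G : MvPolynomial (Fin 3) ℂ} (hG : Irreducible G) :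
    dualCurve G = {z | homogCoords z ∈ dualCone G} := by
  ext z
  constructor
  · rintro ⟨K, hK, hd, hz⟩
    obtain ⟨u, hu⟩ := (hK.associated_of_dvd hG hd).symm
    obtain ⟨c, hc, hcu⟩ := MvPolynomial.isUnit_iff_eq_C_of_isReduced.1 u.isUnit
    rw [← hu, hcu] at hz
    exact dualCone_subset_mul_C G hc.ne_zero hz
  · exact fun h => ⟨G, hG, dvd_rfl, h⟩

/-- The linear form `x u + y v + w`, the equation in line coordinates of the point
`[x : y : 1]`. -/
noncomputable def pointForm (x y : ℂ) : MvPolynomial (Fin 3) ℂ :=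
  C x * X 0 + C y * X 1 + X 2

/-- The quadratic form `w² - (A u² + 2 B u v + D v²)`. -/
noncomputable def conicForm (A B D : ℂ) : MvPolynomial (Fin 3) ℂ :=
  X 2 ^ 2 - (C A * X 0 ^ 2 + C (2 * B) * (X 0 * X 1) + C D * X 1 ^ 2)

/-- A polynomial of total degree at most one is affine. -/
lemma exists_eval_eq_of_totalDegree_le_one {G : MvPolynomial (Fin 3) ℂ} (hG : G.totalDegree ≤ 1) :
    ∃ (c : ℂ) (g : Fin 3 → ℂ), ∀ p, eval p G = c + (g 0 * p 0 + g 1 * p 1 + g 2 * p 2) := by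
  have hdeg : ∀ m ∈ G.support, m = 0 ∨ ∃ i, m = Finsupp.single i 1 := by
    intro m hm
    have h1 : m.degree ≤ 1 := (le_totalDegree hm).trans hG
    rcases Nat.le_one_iff_eq_zero_or_eq_one.1 h1 with h | h
    · exact Or.inl ((Finsupp.degree_eq_zero_iff m).1 h)
    · right
      have hm0 : m ≠ 0 := by rintro rfl; simp at h
      obtain ⟨i, hi⟩ := Finsupp.ne_iff.1 hm0
      refine ⟨i, ?_⟩
      have hle : Finsupp.single i 1 ≤ m :=
        Finsupp.single_le_iff.2 (Nat.one_le_iff_ne_zero.2 hi)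
      obtain ⟨m', rfl⟩ := le_iff_exists_add.1 hle
      rw [map_add, Finsupp.degree_single] at h
      rw [(Finsupp.degree_eq_zero_iff m').1 (by omega), add_zero]
  refine ⟨coeff 0 G, fun i => coeff (Finsupp.single i 1) G, fun p => ?_⟩
  have hGe : G = C (coeff 0 G) + ∑ i, C (coeff (Finsupp.single i 1) G) * X i := by
    ext m
    by_cases hm : m = 0 ∨ ∃ i, m = Finsupp.single i 1
    · rcases hm with rfl | ⟨i, rfl⟩
      · simp [coeff_sum, coeff_C_mul, coeff_X]
      · have h0 : (0 : Fin 3 →₀ ℕ) ≠ Finsupp.single i 1 :=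
          (Finsupp.single_ne_zero.2 one_ne_zero).symm
        simp [coeff_sum, coeff_C_mul, coeff_X, coeff_C, Finsupp.single_left_inj, h0]
    · have h0 : coeff m G = 0 := by
        by_contra h
        exact hm (hdeg m (mem_support_iff.2 h))
      push Not at hm
      rw [h0]
      simp [coeff_sum, coeff_C_mul, coeff_X, coeff_C, hm.1.symm, fun i => (hm.2 i).symm]
  conv_lhs => rw [hGe]
  simp [Fin.sum_univ_three, add_assoc]

lemma isUnit_of_totalDegree_eq_zero {G : MvPolynomial (Fin 3) ℂ} (hG : G.totalDegree = 0)
    (h0 : G ≠ 0) : IsUnit G := by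
  rw [totalDegree_eq_zero_iff_eq_C] at hG
  rw [hG] at h0 ⊢
  exact (isUnit_iff_ne_zero.2 fun h => h0 (by rw [h, C_0])).map C

lemma not_isUnit_of_eval_eq_zero {F : MvPolynomial (Fin 3) ℂ} {p : Fin 3 → ℂ}
    (h : eval p F = 0) : ¬ IsUnit F := fun hu => by
  have := hu.map (eval p)
  rw [h] at this
  exact not_isUnit_zero this

lemma totalDegree_pointForm_le (x y : ℂ) : (pointForm x y).totalDegree ≤ 1 := by
  refine IsHomogeneous.totalDegree_le (φ := pointForm x y) ?_
  refine ((IsHomogeneous.add ?_ ?_).add (isHomogeneous_X _ _))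
  · exact (isHomogeneous_X _ _).C_mul _
  · exact (isHomogeneous_X _ _).C_mul _

lemma totalDegree_conicForm_le (A B D : ℂ) : (conicForm A B D).totalDegree ≤ 2 := by
  have h2 (i : Fin 3) : (X i ^ 2 : MvPolynomial (Fin 3) ℂ).IsHomogeneous 2 := isHomogeneous_X_pow _ _
  refine IsHomogeneous.totalDegree_le (φ := conicForm A B D) ?_
  exact (h2 2).sub ((((h2 0).C_mul _).add
    (((isHomogeneous_X _ 0).mul (isHomogeneous_X _ 1)).C_mul _)).add ((h2 1).C_mul _))

lemma irreducible_pointForm (x y : ℂ) : Irreducible (pointForm x y) where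
  not_isUnit := not_isUnit_of_eval_eq_zero (p := 0) (by simp [pointForm])
  isUnit_or_isUnit G H hGH := by
    have h0 : G * H ≠ 0 := by
      rw [← hGH]
      intro h
      simpa [pointForm] using congr(eval ![0, 0, 1] $h)
    have hG := left_ne_zero_of_mul h0
    have hH := right_ne_zero_of_mul h0
    have hd := totalDegree_pointForm_le x y
    rw [hGH, totalDegree_mul_of_isDomain hG hH] at hd
    rcases Nat.eq_zero_or_pos G.totalDegree with h | h
    · exact Or.inl (isUnit_of_totalDegree_eq_zero h hG)
    · exact Or.inr (isUnit_of_totalDegree_eq_zero (by omega) hH)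

lemma irreducible_conicForm {A B D : ℂ} (h : A * D - B ^ 2 ≠ 0) :
    Irreducible (conicForm A B D) where
  not_isUnit := not_isUnit_of_eval_eq_zero (p := 0) (by simp [conicForm])
  isUnit_or_isUnit G H hGH := by
    have h0 : G * H ≠ 0 := by
      rw [← hGH]
      intro h
      simpa [conicForm] using congr(eval ![0, 0, 1] $h)
    have hG := left_ne_zero_of_mul h0
    have hH := right_ne_zero_of_mul h0
    have hd := totalDegree_conicForm_le A B D
    rw [hGH, totalDegree_mul_of_isDomain hG hH] at hd
    rcases Nat.eq_zero_or_pos G.totalDegree with h1 | h1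
    · exact Or.inl (isUnit_of_totalDegree_eq_zero h1 hG)
    rcases Nat.eq_zero_or_pos H.totalDegree with h2 | h2
    · exact Or.inr (isUnit_of_totalDegree_eq_zero h2 hH)
    exfalso
    obtain ⟨c, g, hg⟩ := exists_eval_eq_of_totalDegree_le_one (G := G) (by omega)
    obtain ⟨e, k, hk⟩ := exists_eval_eq_of_totalDegree_le_one (G := H) (by omega)
    have key (u v w : ℂ) : w ^ 2 - (A * u ^ 2 + 2 * B * (u * v) + D * v ^ 2) =
        (c + (g 0 * u + g 1 * v + g 2 * w)) * (e + (k 0 * u + k 1 * v + k 2 * w)) := by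
      have := congr(eval ![u, v, w] $hGH)
      rw [eval_mul, hg, hk] at this
      simpa [conicForm] using this
    -- The factors are not assumed homogeneous; second differences at the origin remove constant and
    -- linear terms and isolate the quadratic coefficients.
    have k0 := key 0 0 0
    have e00 : g 0 * k 0 = -A := by
      linear_combination k0 - (key 1 0 0 + key (-1) 0 0) / 2
    have e11 : g 1 * k 1 = -D := by
      linear_combination k0 - (key 0 1 0 + key 0 (-1) 0) / 2
    have e22 : g 2 * k 2 = 1 := by
      linear_combination k0 - (key 0 0 1 + key 0 0 (-1)) / 2
    have e01 : g 0 * k 1 + g 1 * k 0 = -(2 * B) := by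
      linear_combination key 1 0 0 + key 0 1 0 - key 1 1 0 - k0
    have e02 : g 0 * k 2 + g 2 * k 0 = 0 := by
      linear_combination key 1 0 0 + key 0 0 1 - key 1 0 1 - k0
    have e12 : g 1 * k 2 + g 2 * k 1 = 0 := by
      linear_combination key 0 1 0 + key 0 0 1 - key 0 1 1 - k0
    -- Vanishing mixed terms with w make (g₀, g₁) and (k₀, k₁) proportional, while AD - B² = -(g₀k₁
    -- - g₁k₀)²/4.
    have hs : g 0 * k 1 - g 1 * k 0 = 0 := by
      linear_combination (-(g 0 * k 1 - g 1 * k 0)) * e22 + k 2 * g 0 * e12 - k 2 * g 1 * e02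
    apply h
    linear_combination D * e00 - (g 0 * k 0) * e11
      + (g 0 * k 1 + g 1 * k 0 - 2 * B) / 4 * e01 - (g 0 * k 1 - g 1 * k 0) / 4 * hs

lemma homogCoords_mem_dualCone_pointForm {z : ℂ} {x y : ℝ} :
    homogCoords z ∈ dualCone (pointForm x y) ↔ z = ⟨x, y⟩ := by
  have hgrad (p : Fin 3 → ℂ) : grad (pointForm x y) p = ![(x : ℂ), (y : ℂ), 1] := by
    ext i
    fin_cases i <;> simp [grad, pointForm, pderiv_X]
  constructor
  · intro h
    have h0 := h (X 0 - C (x : ℂ) * X 2) fun p t _ => by simp [hgrad]; ring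
    have h1 := h (X 1 - C (y : ℂ) * X 2) fun p t _ => by simp [hgrad]; ring
    simp only [homogCoords, eval_sub, eval_mul, eval_X, eval_C, Matrix.cons_val, mul_one,
      sub_eq_zero] at h0 h1
    exact Complex.ext (by exact_mod_cast h0) (by exact_mod_cast h1)
  · rintro rfl P hP
    -- The gradient is constant, so even the vertex 0 of the cone yields the dual point.
    have := hP 0 1 (by simp [pointForm])
    rwa [hgrad, one_smul] at this

lemma homogCoords_mem_dualCone_conicForm {z : ℂ} {A B D : ℂ} (h : A * D - B ^ 2 ≠ 0) :
    homogCoords z ∈ dualCone (conicForm A B D) ↔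
      D * z.re ^ 2 - 2 * B * z.re * z.im + A * z.im ^ 2 = A * D - B ^ 2 := by
  have hgrad (p : Fin 3 → ℂ) : grad (conicForm A B D) p =
      ![-2 * (A * p 0 + B * p 1), -2 * (B * p 0 + D * p 1), 2 * p 2] := by
    ext i
    fin_cases i <;> simp [grad, conicForm, pderiv_X, Derivation.leibniz_pow] <;> ring
  constructor
  · intro hz
    -- The adjugate quadratic form vanishes at every gradient taken on the conic.
    have h0 := hz (C D * X 0 ^ 2 - C (2 * B) * (X 0 * X 1) + C A * X 1 ^ 2
      - C (A * D - B ^ 2) * X 2 ^ 2) fun p t hp => by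
        simp only [conicForm, map_sub, map_add, map_mul, map_pow, eval_X, eval_C] at hp
        simp [hgrad]
        linear_combination (-4) * t ^ 2 * (A * D - B ^ 2) * hp
    simp [homogCoords] at h0
    linear_combination h0
  · intro hz P hP
    -- The gradient map is linear and invertible; this is the preimage of [x : y : 1].
    set p : Fin 3 → ℂ := ![-(D * z.re - B * z.im) / (2 * (A * D - B ^ 2)),
      -(A * z.im - B * z.re) / (2 * (A * D - B ^ 2)), 1 / 2] with hp
    have hpq : grad (conicForm A B D) p = homogCoords z := by
      rw [hgrad, homogCoords, hp]
      ext i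
      fin_cases i
      · simp
        field_simp
        ring
      · simp
        field_simp
        linear_combination (z.im : ℂ) * mul_inv_cancel₀ h
      · simp
    rw [← hpq, ← one_smul ℂ (grad _ _)]
    refine hP p 1 ?_
    simp [conicForm, hp]
    field_simp
    linear_combination (-(A * D - B ^ 2)) * hz

/-- Antisymmetric vectors contribute the factor de - pq, symmetric ones the other two. -/
lemma det_centrosymmetric_tridiagonal {R : Type*} [CommRing R] (d e p q r s : R) :
    (!![d, p, 0, 0, 0; q, e, r, 0, 0; 0, s, d, s, 0; 0, 0, r, e, q; 0, 0, 0, p, d]).det =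
      d * (d * e - p * q) * (d * e - p * q - 2 * (r * s)) := by
  simp [Matrix.det_succ_row_zero, Fin.sum_univ_succ, Fin.succAbove]
  ring

/-- The form `w² - (Re(ζ² Δ) + |ζ|² M / 2) / 2` with `ζ = u - iv`, whose dual is the hyperbola with
foci `±√Δ`. -/
noncomputable def hyperbolaForm (Δ : ℂ) (M : ℝ) : MvPolynomial (Fin 3) ℂ :=
  conicForm ((Δ.re / 2 + M / 4 : ℝ) : ℂ) ((Δ.im / 2 : ℝ) : ℂ) ((-Δ.re / 2 + M / 4 : ℝ) : ℂ)

lemma dualCurve_hyperbolaForm {Δ δ : ℂ} {M l : ℝ} (hδ : δ ^ 2 = Δ)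
    (hl : l = Real.sqrt (2 * ‖Δ‖ - M)) (h : |M| < 2 * ‖Δ‖) :
    dualCurve (hyperbolaForm Δ M) = hyperbola δ (-δ) l := by
  have hΔ : ‖Δ‖ ^ 2 = Δ.re ^ 2 + Δ.im ^ 2 := by
    rw [Complex.sq_norm, Complex.normSq_apply]; ring
  have hdet : (Δ.re / 2 + M / 4) * (-Δ.re / 2 + M / 4) - (Δ.im / 2) ^ 2
      = -(4 * ‖Δ‖ ^ 2 - M ^ 2) / 16 := by
    rw [hΔ]; ring
  have hne : (Δ.re / 2 + M / 4) * (-Δ.re / 2 + M / 4) - (Δ.im / 2) ^ 2 ≠ 0 := by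
    have := pow_lt_pow_left₀ h (abs_nonneg M) two_ne_zero
    rw [sq_abs] at this
    rw [hdet]
    exact (div_neg_of_neg_of_pos (by linarith) (by norm_num)).ne
  have hne' : ((Δ.re / 2 + M / 4 : ℝ) : ℂ) * ((-Δ.re / 2 + M / 4 : ℝ) : ℂ)
      - ((Δ.im / 2 : ℝ) : ℂ) ^ 2 ≠ 0 := by exact_mod_cast hne
  rw [hyperbolaForm, dualCurve_of_irreducible (irreducible_conicForm hne')]
  ext z
  have hz : ‖z‖ ^ 2 = z.re ^ 2 + z.im ^ 2 := by
    rw [Complex.sq_norm, Complex.normSq_apply]; ring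
  rw [Set.mem_ofPred_eq, homogCoords_mem_dualCone_conicForm hne',
    mem_hyperbola_iff hδ hl (abs_lt.1 h).2 (by linarith [(abs_lt.1 h).1])]
  norm_cast
  rw [hdet]
  simp only [conicValue, hz, hΔ, Complex.mul_re, Complex.conj_re, Complex.conj_im, pow_two z,
    Complex.mul_im]
  constructor <;> intro h <;> linarith

lemma dualCurve_pointForm (x y : ℝ) : dualCurve (pointForm x y) = {⟨x, y⟩} := by
  rw [dualCurve_of_irreducible (irreducible_pointForm _ _)]
  ext z
  exact homogCoords_mem_dualCone_pointForm

/-- With δ = x + iy and M = 2|δ|², the conic is w² - (xu + yv)², a product of two linear forms. -/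
lemma dualCurve_hyperbolaForm_degenerate {Δ δ : ℂ} {M : ℝ} (hδ : δ ^ 2 = Δ)
    (h : 2 * ‖Δ‖ - M = 0) : dualCurve (hyperbolaForm Δ M) = {δ, -δ} := by
  have hM : M = 2 * (δ.re ^ 2 + δ.im ^ 2) := by
    rw [norm_eq_sq hδ, Complex.sq_norm, Complex.normSq_apply] at h
    linarith
  have hfac : hyperbolaForm Δ M = pointForm (δ.re : ℝ) (δ.im : ℝ)
      * pointForm ((-δ.re : ℝ) : ℂ) ((-δ.im : ℝ) : ℂ) := by
    have h1 : Δ.re / 2 + M / 4 = δ.re ^ 2 := by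
      rw [hM, ← hδ, pow_two δ, Complex.mul_re]; ring
    have h2 : -Δ.re / 2 + M / 4 = δ.im ^ 2 := by
      rw [hM, ← hδ, pow_two δ, Complex.mul_re]; ring
    have h3 : Δ.im / 2 = δ.re * δ.im := by
      rw [← hδ, pow_two δ, Complex.mul_im]; ring
    rw [hyperbolaForm, h1, h2, h3, conicForm, pointForm, pointForm]
    simp only [Complex.ofReal_pow, Complex.ofReal_mul, Complex.ofReal_neg, C_mul, C_neg, C_pow,
      map_ofNat]
    ring
  rw [hfac, dualCurve_mul, dualCurve_pointForm, dualCurve_pointForm]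
  rfl

end Curve

/-! ### Factorization of the determinant form -/

section LineForm

open MvPolynomial ComplexConjugate

/-- The off-diagonal entry `(b - conj c) / 2` of `Re^J(A)`. -/
noncomputable def reEntry (b c : ℂ) : ℂ := (b - conj c) / 2

/-- The off-diagonal entry `(b + conj c) / (2i)` of `Im^J(A)`. -/
noncomputable def imEntry (b c : ℂ) : ℂ := -Complex.I * (b + conj c) / 2

variable {a : ℝ} {b₁ b₂ b₃ b₄ : ℂ}

lemma reJ_centro5 : reJ signature5 (centro5 a b₁ b₂ b₃ b₄) =
    !![(a : ℂ), reEntry b₁ b₄, 0, 0, 0;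
      reEntry b₄ b₁, -a, reEntry b₂ b₃, 0, 0;
      0, reEntry b₃ b₂, a, reEntry b₃ b₂, 0;
      0, 0, reEntry b₂ b₃, -a, reEntry b₄ b₁;
      0, 0, 0, reEntry b₁ b₄, a] := by
  ext i j
  rw [reJ, jAdjoint, signature5, Matrix.smul_apply, Matrix.add_apply, mul_diagonal, diagonal_mul,
    conjTranspose_apply]
  fin_cases i <;> fin_cases j <;> simp [centro5, tridiag5, reEntry] <;> ring

lemma imJ_centro5 : imJ signature5 (centro5 a b₁ b₂ b₃ b₄) =
    !![0, imEntry b₁ b₄, 0, 0, 0;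
      imEntry b₄ b₁, 0, imEntry b₂ b₃, 0, 0;
      0, imEntry b₃ b₂, 0, imEntry b₃ b₂, 0;
      0, 0, imEntry b₂ b₃, 0, imEntry b₄ b₁;
      0, 0, 0, imEntry b₁ b₄, 0] := by
  ext i j
  rw [imJ, jAdjoint, signature5, Matrix.smul_apply, Matrix.sub_apply, mul_diagonal, diagonal_mul,
    conjTranspose_apply]
  fin_cases i <;> fin_cases j <;> simp [centro5, tridiag5, imEntry] <;> ring

/-- The off-diagonal entry of `u Re^J(A) + v Im^J(A)`. -/
noncomputable def entryForm (b c : ℂ) : MvPolynomial (Fin 3) ℂ :=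
  X 0 * C (reEntry b c) + X 1 * C (imEntry b c)

lemma lineForm_centro5_eq_det : lineForm signature5 (centro5 a b₁ b₂ b₃ b₄) =
    (!![X 2 + C (a : ℂ) * X 0, entryForm b₁ b₄, 0, 0, 0;
      entryForm b₄ b₁, X 2 - C (a : ℂ) * X 0, entryForm b₂ b₃, 0, 0;
      0, entryForm b₃ b₂, X 2 + C (a : ℂ) * X 0, entryForm b₃ b₂, 0;
      0, 0, entryForm b₂ b₃, X 2 - C (a : ℂ) * X 0, entryForm b₄ b₁;
      0, 0, 0, entryForm b₁ b₄, X 2 + C (a : ℂ) * X 0]).det := by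
  rw [lineForm, reJ_centro5, imJ_centro5]
  congr 1
  ext1 i j
  rw [Matrix.add_apply, Matrix.add_apply, Matrix.smul_apply, Matrix.smul_apply, Matrix.smul_apply, map_apply, map_apply]
  fin_cases i <;> fin_cases j <;> simp [entryForm] <;> ring

lemma entryForm_mul_entryForm (b c : ℂ) :
    entryForm b c * entryForm c b = C (reEntry b c * reEntry c b) * X 0 ^ 2
      + C (reEntry b c * imEntry c b + imEntry b c * reEntry c b) * (X 0 * X 1)
      + C (imEntry b c * imEntry c b) * X 1 ^ 2 := by
  simp only [entryForm, C_add, C_mul]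
  ring

lemma reEntry_mul_reEntry (b c : ℂ) :
    reEntry b c * reEntry c b =
      (((b * c).re / 2 - (‖b‖ ^ 2 + ‖c‖ ^ 2) / 4 : ℝ) : ℂ) := by
  push_cast
  rw [Complex.re_eq_add_conj, ← Complex.conj_mul', ← Complex.conj_mul', reEntry, reEntry, map_mul]
  ring

lemma imEntry_mul_imEntry (b c : ℂ) :
    imEntry b c * imEntry c b =
      ((-(b * c).re / 2 - (‖b‖ ^ 2 + ‖c‖ ^ 2) / 4 : ℝ) : ℂ) := by
  push_cast
  rw [Complex.re_eq_add_conj, ← Complex.conj_mul', ← Complex.conj_mul', imEntry, imEntry, map_mul]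
  linear_combination ((b + conj c) * (c + conj b) / 4) * Complex.I_sq

lemma reEntry_mul_imEntry_add (b c : ℂ) :
    reEntry b c * imEntry c b + imEntry b c * reEntry c b = ((b * c).im : ℂ) := by
  have h : (1 : ℂ) / Complex.I = -Complex.I := by rw [one_div, Complex.inv_I]
  rw [Complex.im_eq_sub_conj, mul_comm (2 : ℂ), ← div_div, div_eq_mul_one_div _ Complex.I, h,
    reEntry, reEntry, imEntry, imEntry, map_mul]
  ring

lemma X_sq_sub_entryForm (a : ℝ) (b c : ℂ) {Δ : ℂ} {M : ℝ} (hΔ : Δ = (a : ℂ) ^ 2 + b * c)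
    (hM : M = 2 * a ^ 2 - ‖b‖ ^ 2 - ‖c‖ ^ 2) :
    (X 2 + C (a : ℂ) * X 0) * (X 2 - C (a : ℂ) * X 0) - entryForm b c * entryForm c b =
      hyperbolaForm Δ M := by
  have hre : Δ.re = a ^ 2 + (b * c).re := by
    rw [hΔ, ← Complex.ofReal_pow, Complex.add_re, Complex.ofReal_re]
  have him : Δ.im = (b * c).im := by
    rw [hΔ, ← Complex.ofReal_pow, Complex.add_im, Complex.ofReal_im, zero_add]
  have h1 : ((Δ.re / 2 + M / 4 : ℝ) : ℂ) = (a : ℂ) ^ 2 + reEntry b c * reEntry c b := by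
    rw [reEntry_mul_reEntry, hre, hM]; push_cast; ring
  have h2 : 2 * ((Δ.im / 2 : ℝ) : ℂ) = reEntry b c * imEntry c b + imEntry b c * reEntry c b := by
    rw [reEntry_mul_imEntry_add, him]; push_cast; ring
  have h3 : ((-Δ.re / 2 + M / 4 : ℝ) : ℂ) = imEntry b c * imEntry c b := by
    rw [imEntry_mul_imEntry, hre, hM]; push_cast; ring
  rw [hyperbolaForm, conicForm, h1, h2, h3, entryForm_mul_entryForm]
  simp only [C_add, C_pow]
  ring

lemma hyperbolaForm_sub_entryForm (b c : ℂ) {Δ Δ' : ℂ} {M M' : ℝ} (hΔ : Δ' = Δ + 2 * b * c)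
    (hM : M' = M - 2 * ‖b‖ ^ 2 - 2 * ‖c‖ ^ 2) :
    hyperbolaForm Δ M - 2 * (entryForm b c * entryForm c b) = hyperbolaForm Δ' M' := by
  have hre : Δ'.re = Δ.re + 2 * (b * c).re := by
    rw [hΔ, mul_assoc, Complex.add_re, ← Complex.ofReal_ofNat, Complex.re_ofReal_mul]
  have him : Δ'.im = Δ.im + 2 * (b * c).im := by
    rw [hΔ, mul_assoc, Complex.add_im, ← Complex.ofReal_ofNat, Complex.im_ofReal_mul]
  have h1 : ((Δ'.re / 2 + M' / 4 : ℝ) : ℂ) =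
      ((Δ.re / 2 + M / 4 : ℝ) : ℂ) + 2 * (reEntry b c * reEntry c b) := by
    rw [reEntry_mul_reEntry, hre, hM]; push_cast; ring
  have h2 : 2 * ((Δ'.im / 2 : ℝ) : ℂ) = 2 * ((Δ.im / 2 : ℝ) : ℂ)
      + 2 * (reEntry b c * imEntry c b + imEntry b c * reEntry c b) := by
    rw [reEntry_mul_imEntry_add, him]; push_cast; ring
  have h3 : ((-Δ'.re / 2 + M' / 4 : ℝ) : ℂ) =
      ((-Δ.re / 2 + M / 4 : ℝ) : ℂ) + 2 * (imEntry b c * imEntry c b) := by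
    rw [imEntry_mul_imEntry, hre, hM]; push_cast; ring
  have hC2 : (C 2 : MvPolynomial (Fin 3) ℂ) = 2 := map_ofNat C 2
  rw [hyperbolaForm, hyperbolaForm, conicForm, conicForm, h1, h2, h3, entryForm_mul_entryForm]
  simp only [C_add, C_mul, hC2]
  ring

lemma lineForm_centro5 {Δ₁ Δ₂ : ℂ} {M₁ M₂ : ℝ}
    (hΔ₁ : Δ₁ = (a : ℂ) ^ 2 + b₁ * b₄) (hM₁ : M₁ = 2 * a ^ 2 - ‖b₁‖ ^ 2 - ‖b₄‖ ^ 2)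
    (hΔ₂ : Δ₂ = Δ₁ + 2 * b₂ * b₃) (hM₂ : M₂ = M₁ - 2 * ‖b₂‖ ^ 2 - 2 * ‖b₃‖ ^ 2) :
    lineForm signature5 (centro5 a b₁ b₂ b₃ b₄) =
      pointForm a (0 : ℝ) * hyperbolaForm Δ₁ M₁ * hyperbolaForm Δ₂ M₂ := by
  have hp : pointForm a (0 : ℝ) = X 2 + C (a : ℂ) * X 0 := by
    simp [pointForm, add_comm]
  rw [lineForm_centro5_eq_det, det_centrosymmetric_tridiagonal, X_sq_sub_entryForm a b₁ b₄ hΔ₁ hM₁,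
    hyperbolaForm_sub_entryForm b₂ b₃ hΔ₂ hM₂, hp]

lemma boundaryCurve_centro5 {Δ₁ Δ₂ : ℂ} {M₁ M₂ : ℝ}
    (hΔ₁ : Δ₁ = (a : ℂ) ^ 2 + b₁ * b₄) (hM₁ : M₁ = 2 * a ^ 2 - ‖b₁‖ ^ 2 - ‖b₄‖ ^ 2)
    (hΔ₂ : Δ₂ = Δ₁ + 2 * b₂ * b₃) (hM₂ : M₂ = M₁ - 2 * ‖b₂‖ ^ 2 - 2 * ‖b₃‖ ^ 2) :
    boundaryCurve signature5 (centro5 a b₁ b₂ b₃ b₄) =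
      {(a : ℂ)} ∪ dualCurve (hyperbolaForm Δ₁ M₁) ∪ dualCurve (hyperbolaForm Δ₂ M₂) := by
  rw [boundaryCurve_eq_dualCurve, lineForm_centro5 hΔ₁ hM₁ hΔ₂ hM₂, dualCurve_mul, dualCurve_mul,
    dualCurve_pointForm]
  rfl

end LineForm

/-! ### Comparison of the two hyperbolas and conclusion -/

/-- Nondegeneracy of the outer hyperbola makes the inner one at worst degenerate to its foci. -/
lemma abs_lt_or_eq_zero_of_abs_lt {a : ℝ} {b₁ b₂ b₃ b₄ Δ₁ Δ₂ : ℂ} {M₁ M₂ : ℝ}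
    (hΔ₁ : Δ₁ = (a : ℂ) ^ 2 + b₁ * b₄) (hM₁ : M₁ = 2 * a ^ 2 - ‖b₁‖ ^ 2 - ‖b₄‖ ^ 2)
    (hΔ₂ : Δ₂ = Δ₁ + 2 * b₂ * b₃) (hM₂ : M₂ = M₁ - 2 * ‖b₂‖ ^ 2 - 2 * ‖b₃‖ ^ 2)
    (h : |M₂| < 2 * ‖Δ₂‖) : |M₁| < 2 * ‖Δ₁‖ ∨ 2 * ‖Δ₁‖ - M₁ = 0 := by
  -- Unconditional: a² = |Δ₁ - b₁b₄| ≤ |Δ₁| + |b₁||b₄|, and 2|b₁||b₄| ≤ |b₁|² + |b₄|².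
  have h1 : M₁ ≤ 2 * ‖Δ₁‖ := by
    have := norm_sub_le Δ₁ (b₁ * b₄)
    have ha : ‖Δ₁ - b₁ * b₄‖ = a ^ 2 := by
      rw [hΔ₁, add_sub_cancel_right, norm_pow, Complex.norm_real, Real.norm_eq_abs, sq_abs]
    rw [ha, norm_mul] at this
    nlinarith [sq_nonneg (‖b₁‖ - ‖b₄‖)]
  -- Passing from index 2 to 1 raises M by 2|b₂|² + 2|b₃|², and lowers 2|Δ| by at most 4|b₂||b₃|,
  -- which is no more.
  have h2 : -M₁ < 2 * ‖Δ₁‖ := by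
    have h3 : ‖Δ₂‖ ≤ ‖Δ₁‖ + 2 * (‖b₂‖ * ‖b₃‖) := by
      rw [hΔ₂]
      refine (norm_add_le _ _).trans_eq ?_
      simp [mul_assoc]
    nlinarith [sq_nonneg (‖b₂‖ - ‖b₃‖), neg_abs_le M₂]
  rcases h1.lt_or_eq with h3 | h3
  · exact Or.inl (abs_lt.2 ⟨by linarith, h3⟩)
  · exact Or.inr (by linarith)

/-- The Krein space numerical range is the closed hyperbolic disc when its hyperbola is
nondegenerate. -/
lemma knr_centro5_eq {a : ℝ} {b₁ b₂ b₃ b₄ Δ δ : ℂ} {M l : ℝ}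
    (hΔ : Δ = (a : ℂ) ^ 2 + b₁ * b₄ + 2 * b₂ * b₃)
    (hM : M = 2 * a ^ 2 - ‖b₁‖ ^ 2 - ‖b₄‖ ^ 2 - 2 * ‖b₂‖ ^ 2 - 2 * ‖b₃‖ ^ 2)
    (hδ : δ ^ 2 = Δ) (hl : l = Real.sqrt (2 * ‖Δ‖ - M)) (h : |M| < 2 * ‖Δ‖) :
    knr signature5 (centro5 a b₁ b₂ b₃ b₄) = hyperbolicDisc δ (-δ) l := by
  have h1 : M < 2 * ‖Δ‖ := (abs_lt.1 h).2
  have h2 : -M ≤ 2 * ‖Δ‖ := by linarith [(abs_lt.1 h).1]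
  ext z
  constructor
  · exact fun hz => (mem_hyperbolicDisc_iff_norm_le hδ hl h1.le h2).2
      (knr_centro5_subset hΔ hM hz)
  · exact fun hz => mem_knr_centro5_of_conicValue hΔ hM h
      ((mem_hyperbolicDisc_iff hδ hl h1 h2).1 hz)

end KreinRange

theorem theorem3p2 (a : ℝ) (b₁ b₂ b₃ b₄ : ℂ)
    (J A : Matrix (Fin 5) (Fin 5) ℂ)
    (hJ : J = Matrix.diagonal ![1, -1, 1, -1, 1])
    (hA : A = KreinRange.tridiag5 ![b₄, b₃, b₂, b₁]
      ![(a : ℂ), -(a : ℂ), (a : ℂ), -(a : ℂ), (a : ℂ)] ![b₁, b₂, b₃, b₄])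
    (Δ₁ Δ₂ : ℂ) (M₁ M₂ : ℝ)
    (hΔ₁ : Δ₁ = (a : ℂ) ^ 2 + b₁ * b₄)
    (hM₁ : M₁ = 2 * a ^ 2 - ‖b₁‖ ^ 2 - ‖b₄‖ ^ 2)
    (hΔ₂ : Δ₂ = Δ₁ + 2 * b₂ * b₃)
    (hM₂ : M₂ = M₁ - 2 * ‖b₂‖ ^ 2 - 2 * ‖b₃‖ ^ 2)
    -- `δₖ` is a square root of `Δₖ`, and `lₖ` the length of the non-transverse axis
    (δ₁ δ₂ : ℂ) (hδ₁ : δ₁ ^ 2 = Δ₁) (hδ₂ : δ₂ ^ 2 = Δ₂)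
    (l₁ l₂ : ℝ) (hl₁ : l₁ = Real.sqrt (2 * ‖Δ₁‖ - M₁)) (hl₂ : l₂ = Real.sqrt (2 * ‖Δ₂‖ - M₂)) :
    ((KreinRange.IsNondegenerateHyperbola δ₂ (-δ₂) l₂ ∧
        frontier (KreinRange.knr J A) = KreinRange.hyperbola δ₂ (-δ₂) l₂) ↔
      |M₂| < 2 * ‖Δ₂‖) ∧
    (|M₂| < 2 * ‖Δ₂‖ →
      KreinRange.knr J A = KreinRange.hyperbolicDisc δ₂ (-δ₂) l₂ ∧
      ((KreinRange.IsNondegenerateHyperbola δ₁ (-δ₁) l₁ ∧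
          KreinRange.boundaryCurve J A =
            {(a : ℂ)} ∪ KreinRange.hyperbola δ₁ (-δ₁) l₁ ∪ KreinRange.hyperbola δ₂ (-δ₂) l₂) ∨
        (2 * ‖Δ₁‖ - M₁ = 0 ∧
          KreinRange.boundaryCurve J A =
            {(a : ℂ)} ∪ {δ₁, -δ₁} ∪ KreinRange.hyperbola δ₂ (-δ₂) l₂))) := by
  obtain rfl : J = KreinRange.signature5 := hJ
  obtain rfl : A = KreinRange.centro5 a b₁ b₂ b₃ b₄ := hA
  have hnd := KreinRange.isNondegenerateHyperbola_iff hδ₂ hl₂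
  have hknr := KreinRange.knr_centro5_eq (b₁ := b₁) (b₂ := b₂) (b₃ := b₃) (b₄ := b₄)
    (by rw [hΔ₂, hΔ₁]) (by rw [hM₂, hM₁]) hδ₂ hl₂
  refine ⟨⟨fun h => hnd.1 h.1, fun h => ⟨hnd.2 h, ?_⟩⟩, fun h => ⟨hknr h, ?_⟩⟩
  · rw [hknr h]
    exact KreinRange.frontier_hyperbolicDisc hδ₂ hl₂ (abs_lt.1 h).2 (by linarith [(abs_lt.1 h).1])
  · rw [KreinRange.boundaryCurve_centro5 hΔ₁ hM₁ hΔ₂ hM₂,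
      KreinRange.dualCurve_hyperbolaForm hδ₂ hl₂ h]
    rcases KreinRange.abs_lt_or_eq_zero_of_abs_lt hΔ₁ hM₁ hΔ₂ hM₂ h with h1 | h1
    · left
      rw [KreinRange.dualCurve_hyperbolaForm hδ₁ hl₁ h1]
      exact ⟨(KreinRange.isNondegenerateHyperbola_iff hδ₁ hl₁).2 h1, rfl⟩
    · right
      rw [KreinRange.dualCurve_hyperbolaForm_degenerate hδ₁ h1]
      exact ⟨h1, rfl⟩
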